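/- Let $G,K_1,K_2$ be nonnegative integers. Consider the model $U=r_0(Y)+r_1(X_1)+r_2(X_2)$, where $U,Y$ take values in $\mathbb{R}^G$, $X_i$ takes values in $\mathbb{R}^{K_i}$, and $U$ is independent of $(X_1,X_2)$ with density $f_U$. The parameter space is given by sets $\Gamma_0$ of functions $\mathbb{R}^G\to\mathbb{R}^G$, $\Gamma_i$ of functions $\mathbb{R}^{K_i}\to\mathbb{R}^G$ ($i=1,2$), and $\Phi$ of probability densities on $\mathbb{R}^G$. Write $Dg$ for the Jacobian matrix of $g$. Call a probability density $f$ on $\mathbb{R}^G$ *admissible* if it is continuously differentiable, its support (the closure of $\{f\neq0\}$) is $\mathbb{R}^G$, $\int u f(u)\,du=0$ and $\int uu^{\mathsf T}f(u)\,du=I_G$. Assumption PAR: every element of $\Gamma_0,\Gamma_1,\Gamma_2$ is twice continuously differentiable; every $\tilde r_0\in\Gamma_0$ is a bijection of $\mathbb{R}^G$ with $\det D\tilde r_0(y)>0$ for all $y$; every element of $\Phi$ is admissible. The true parameters are $r_i\in\Gamma_i$ ($i=0,1,2$) and $f_U\in\Phi$. Assumption DGP: (1) the image of $(x_1,x_2)\mapsto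 r_1(x_1)+r_2(x_2)$ is $\mathbb{R}^G$; (2) $\operatorname{rank}Dr_i(x_i)=G$ for all $x_i\in\mathbb{R}^{K_i}$, $i=1,2$; (3) there is $u^*$ with $f_U(u^*)>0$ and $D(\log f_U)(u^*)=0$; (4) there are $\bar u_1,\dots,\bar u_G\in\mathbb{R}^G$ with $f_U(\bar u_i)>0$ such that the vectors $D(\log f_U)(\bar u_i)^{\mathsf T}$ span $\mathbb{R}^G$. Parameters $(\tilde r_0,\tilde r_1,\tilde r_2,f_{\tilde U})$ and $(r_0,r_1,r_2,f_U)$ are *observationally equivalent* if they imply the same conditional densities of $Y$ given $(X_1,X_2)=(x_1,x_2)$, i.e. $$f_{\tilde U}\big(\tilde r_0(y)+\tilde r_1(x_1)+\tilde r_2(x_2)\big)\,|\det D\tilde r_0(y)|=f_U\big(r_0(y)+r_1(x_1)+r_2(x_2)\big)\,|\det Dr_0(y)|$$ for all $(y,x_1,x_2)\in\mathbb{R}^G\times\mathbb{R}^{K_1}\times\mathbb{R}^{K_2}$. **Proposition.** Suppose PAR and DGP hold, and that $\Phi$ contains every admissible density of the form $u\mapsto f_U(Q^{\mathsf T}u)$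 with $Q\in\mathbb{R}^{G\times G}$ orthogonal (for instance, $\Phi$ is the set of all admissible densities). Let $\tilde r_i\in\Gamma_i$ for $i=0,1,2$. Then there exists $f_{\tilde U}\in\Phi$ such that $(\tilde r_0,\tilde r_1,\tilde r_2,f_{\tilde U})$ is observationally equivalent to $(r_0,r_1,r_2,f_U)$ if and only if there exists an orthogonal matrix $Q\in\mathbb{R}^{G\times G}$ such that $$\tilde r_0(y)+\tilde r_1(x_1)+\tilde r_2(x_2)=Q\,[r_0(y)+r_1(x_1)+r_2(x_2)]\quad\text{for all }(y,x_1,x_2)\in\mathbb{R}^G\times\mathbb{R}^{K_1}\times\mathbb{R}^{K_2}.$$ -/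

import Mathlib

open MeasureTheory
open scoped Matrix

noncomputable section

namespace SimEq

/-- The Jacobian matrix `[∂gᵢ/∂zⱼ (z)]` of `g : ℝᵐ → ℝⁿ` at `z`. -/
def jacobian {m n : ℕ} (g : (Fin m → ℝ) → (Fin n → ℝ)) (z : Fin m → ℝ) :
    Matrix (Fin n) (Fin m) ℝ :=
  Matrix.of fun i j => fderiv ℝ g z (Pi.single j 1) i

/-- The (transposed) derivative `D(log f)(u)ᵀ`, as a vector of partial derivatives.
It is meaningful at points where `f u > 0`. -/
def score {G : ℕ} (f : (Fin G → ℝ) → ℝ) (u : Fin G → ℝ) : Fin G → ℝ :=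
  fun i => fderiv ℝ (fun v => Real.log (f v)) u (Pi.single i 1)

/-- A probability density function on `ℝᴳ` with respect to Lebesgue measure. -/
structure IsDensity {G : ℕ} (f : (Fin G → ℝ) → ℝ) : Prop where
  nonneg : ∀ u, 0 ≤ f u
  integrable : Integrable f
  integral_eq_one : ∫ u, f u = 1

/-- Admissible densities: continuously differentiable, with support `ℝᴳ`, mean zero and
identity covariance matrix. -/
structure IsAdmissibleDensity {G : ℕ} (f : (Fin G → ℝ) → ℝ) : Prop where
  isDensity : IsDensity f
  contDiff : ContDiff ℝ 1 f
  support : tsupport f = Set.univ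
  integrable_mean : ∀ i, Integrable fun u : Fin G → ℝ => u i * f u
  mean : ∀ i, ∫ u : Fin G → ℝ, u i * f u = 0
  integrable_cov : ∀ i j, Integrable fun u : Fin G → ℝ => u i * u j * f u
  cov : ∀ i j, ∫ u : Fin G → ℝ, u i * u j * f u = (1 : Matrix (Fin G) (Fin G) ℝ) i j

/-- Assumption PAR: restrictions on the parameter space `Γ₀ × Γ₁ × Γ₂ × Φ`. -/
structure PAR {G K₁ K₂ : ℕ}
    (Γ₀ : Set ((Fin G → ℝ) → (Fin G → ℝ)))
    (Γ₁ : Set ((Fin K₁ → ℝ) → (Fin G → ℝ)))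
    (Γ₂ : Set ((Fin K₂ → ℝ) → (Fin G → ℝ)))
    (Φ : Set ((Fin G → ℝ) → ℝ)) : Prop where
  contDiff₀ : ∀ r ∈ Γ₀, ContDiff ℝ 2 r
  contDiff₁ : ∀ r ∈ Γ₁, ContDiff ℝ 2 r
  contDiff₂ : ∀ r ∈ Γ₂, ContDiff ℝ 2 r
  bijective : ∀ r ∈ Γ₀, Function.Bijective r
  det_pos : ∀ r ∈ Γ₀, ∀ y, 0 < (jacobian r y).det
  density : ∀ f ∈ Φ, IsAdmissibleDensity f

/-- Assumption DGP: restrictions on the true parameters `(r₀, r₁, r₂, f)` only (none of them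
involves `r₀`). The positivity requirements say that `log f` is defined at the points
in question. -/
structure DGP {G K₁ K₂ : ℕ}
    (r₁ : (Fin K₁ → ℝ) → (Fin G → ℝ)) (r₂ : (Fin K₂ → ℝ) → (Fin G → ℝ))
    (f : (Fin G → ℝ) → ℝ) : Prop where
  image : Set.range (fun x : (Fin K₁ → ℝ) × (Fin K₂ → ℝ) => r₁ x.1 + r₂ x.2) = Set.univ
  rank₁ : ∀ x, (jacobian r₁ x).rank = G
  rank₂ : ∀ x, (jacobian r₂ x).rank = G
  mode : ∃ u, 0 < f u ∧ score f u = 0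
  span : ∃ u : Fin G → (Fin G → ℝ), (∀ i, 0 < f (u i)) ∧
    Submodule.span ℝ (Set.range fun i => score f (u i)) = ⊤

/-- The conditional density of `Y` at `y` given `(X₁, X₂) = (x₁, x₂)` in the model
`U = r₀(Y) + r₁(X₁) + r₂(X₂)`, where `U` is independent of `(X₁, X₂)` with density `f`. -/
def condDensity {G K₁ K₂ : ℕ} (r₀ : (Fin G → ℝ) → (Fin G → ℝ))
    (r₁ : (Fin K₁ → ℝ) → (Fin G → ℝ)) (r₂ : (Fin K₂ → ℝ) → (Fin G → ℝ))
    (f : (Fin G → ℝ) → ℝ) (x₁ : Fin K₁ → ℝ) (x₂ : Fin K₂ → ℝ) (y : Fin G → ℝ) : ℝ :=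
  f (r₀ y + r₁ x₁ + r₂ x₂) * |(jacobian r₀ y).det|

/-- Observational equivalence: both parameters imply identical conditional densities. -/
def ObsEquiv {G K₁ K₂ : ℕ}
    (s₀ : (Fin G → ℝ) → (Fin G → ℝ)) (s₁ : (Fin K₁ → ℝ) → (Fin G → ℝ))
    (s₂ : (Fin K₂ → ℝ) → (Fin G → ℝ)) (g : (Fin G → ℝ) → ℝ)
    (r₀ : (Fin G → ℝ) → (Fin G → ℝ)) (r₁ : (Fin K₁ → ℝ) → (Fin G → ℝ))
    (r₂ : (Fin K₂ → ℝ) → (Fin G → ℝ)) (f : (Fin G → ℝ) → ℝ) : Prop :=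
  ∀ x₁ x₂ y, condDensity s₀ s₁ s₂ g x₁ x₂ y = condDensity r₀ r₁ r₂ f x₁ x₂ y

end SimEq

end

namespace SimEq

open Filter Topology

/-! ### Jacobian matrices as derivatives. -/

section Jacobian

variable {m n : ℕ}

/-! Equivalence reads `g (s₀ + s₁ + s₂) = f (r₀ + r₁ + r₂) * ρ y` with `ρ = det Dr₀ / det Ds₀`.
Differentiating its logarithm in `xᵢ` relates the two scores through `Dsᵢ` and `Drᵢ`, with no
Jacobian term. For fixed `x`, varying `y` brings the index to every point, so the spanning scores of
`f` test vectors: `ker Dsᵢ ≤ ker Drᵢ`, and the rank condition gives `Drᵢ = Bᵢ(xᵢ) Dsᵢ` with `Dsᵢ`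
onto. The score of `g` is then `Bᵢᵀ` times that of `f` for both `i`, so `B₁(x₁) = B₂(x₂)` for all
`x₁, x₂`, and both equal a constant `M`. In the `y` direction `D log ρ` appears; for each `y` some
`x` puts the index at the critical point of `log f`, where both scores vanish, so `D log ρ = 0` and
`Dr₀ = M Ds₀` (`ObsEquiv.exists_fderiv_eq_mulVec`). Integrating, `r = M s + c`, hence `g v = |det M|
f (M v + c)`. Zero means force `c = 0` and unit covariances force `M Mᵀ = 1`
(`IsAdmissibleDensity.orthogonal_of_affine`). Conversely, `f (Qᵀ u)` is admissible and `|det Q| =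
1`. -/

lemma jacobian_eq_toMatrix' (g : (Fin m → ℝ) → (Fin n → ℝ)) (z : Fin m → ℝ) :
    jacobian g z = LinearMap.toMatrix' (fderiv ℝ g z : (Fin m → ℝ) →ₗ[ℝ] (Fin n → ℝ)) := by
  ext i j
  simp [jacobian, LinearMap.toMatrix'_apply]

lemma jacobian_mulVec (g : (Fin m → ℝ) → (Fin n → ℝ)) (z w : Fin m → ℝ) :
    jacobian g z *ᵥ w = fderiv ℝ g z w := by
  rw [jacobian_eq_toMatrix', LinearMap.toMatrix'_mulVec]
  rfl

lemma surjective_fderiv_of_rank_jacobian {g : (Fin m → ℝ) → (Fin n → ℝ)} {z : Fin m → ℝ}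
    (h : (jacobian g z).rank = n) : Function.Surjective (fderiv ℝ g z) := by
  have hr : LinearMap.range (jacobian g z).mulVecLin = ⊤ := by
    apply Submodule.eq_top_of_finrank_eq
    rw [Module.finrank_fin_fun]
    exact h
  intro w
  obtain ⟨v, hv⟩ := LinearMap.range_eq_top.1 hr w
  exact ⟨v, by rw [← jacobian_mulVec]; exact hv⟩

lemma differentiable_det_jacobian {g : (Fin n → ℝ) → (Fin n → ℝ)} (hg : ContDiff ℝ 2 g) :
    Differentiable ℝ fun y => (jacobian g y).det := by
  have hd : ContDiff ℝ 1 (fderiv ℝ g) := hg.fderiv_right (by norm_num)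
  have hj : ∀ i j, ContDiff ℝ 1 fun y => jacobian g y i j := fun i j =>
    contDiff_pi.1 (hd.clm_apply (contDiff_const (c := Pi.single j 1))) i
  have h : ContDiff ℝ 1 fun y => (jacobian g y).det := by
    simp only [Matrix.det_apply]
    exact ContDiff.sum fun σ _ => (contDiff_prod fun i _ => hj _ _).const_smul _
  exact h.differentiable (by norm_num)

end Jacobian

/-! ### Scores: separation of vectors and logarithmic differentiation. -/

section Score

variable {m n : ℕ}

lemma fderiv_log_eq_dotProduct_score (f : (Fin n → ℝ) → ℝ) (u w : Fin n → ℝ) :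
    fderiv ℝ (fun v => Real.log (f v)) u w = score f u ⬝ᵥ w := by
  conv_lhs => rw [pi_eq_sum_univ' w, map_sum]
  simp only [dotProduct, score]
  refine Finset.sum_congr rfl fun i _ => ?_
  rw [map_smul, smul_eq_mul, mul_comm]

lemma eq_zero_of_score_dotProduct_eq_zero {ι : Type*} {f : (Fin n → ℝ) → ℝ}
    {u : ι → (Fin n → ℝ)} (hu : Submodule.span ℝ (Set.range fun i => score f (u i)) = ⊤)
    {w : Fin n → ℝ} (hw : ∀ i, score f (u i) ⬝ᵥ w = 0) : w = 0 := by
  have h : ∀ v ∈ Submodule.span ℝ (Set.range fun i => score f (u i)), v ⬝ᵥ w = 0 := by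
    intro v hv
    induction hv using Submodule.span_induction with
    | mem x hx => obtain ⟨i, rfl⟩ := hx; exact hw i
    | zero => simp
    | add x y _ _ hx hy => rw [add_dotProduct, hx, hy, add_zero]
    | smul a x _ hx => rw [smul_dotProduct, hx, smul_zero]
  exact dotProduct_self_eq_zero.1 (h w (hu ▸ Submodule.mem_top))

/-- Logarithmic differentiation of the identity `g ∘ ψ = (f ∘ φ) * ρ`. -/
lemma score_dotProduct_fderiv {f g : (Fin n → ℝ) → ℝ} {φ ψ : (Fin m → ℝ) → (Fin n → ℝ)}
    {ρ : (Fin m → ℝ) → ℝ} {x : Fin m → ℝ}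
    (hf : Differentiable ℝ f) (hg : Differentiable ℝ g)
    (hφ : DifferentiableAt ℝ φ x) (hψ : DifferentiableAt ℝ ψ x) (hρ : DifferentiableAt ℝ ρ x)
    (hρ0 : ∀ z, 0 < ρ z) (hx : 0 < f (φ x)) (h : ∀ z, g (ψ z) = f (φ z) * ρ z)
    (w : Fin m → ℝ) :
    score g (ψ x) ⬝ᵥ fderiv ℝ ψ x w =
      score f (φ x) ⬝ᵥ fderiv ℝ φ x w + fderiv ℝ (fun z => Real.log (ρ z)) x w := by
  have hgx : 0 < g (ψ x) := by rw [h]; exact mul_pos hx (hρ0 x)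
  have hLg : DifferentiableAt ℝ (fun v => Real.log (g v)) (ψ x) := (hg _).log hgx.ne'
  have hLf : DifferentiableAt ℝ (fun v => Real.log (f v)) (φ x) := (hf _).log hx.ne'
  have hLρ : DifferentiableAt ℝ (fun z => Real.log (ρ z)) x := hρ.log (hρ0 x).ne'
  have h1 := hLg.hasFDerivAt.comp x hψ.hasFDerivAt
  have h2 := (hLf.hasFDerivAt.comp x hφ.hasFDerivAt).add hLρ.hasFDerivAt
  -- Densities may vanish at some points, so the logarithmic identity is only claimed near `x`.
  have hev : ∀ᶠ z in 𝓝 x, 0 < f (φ z) :=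
    ((hf.continuous.continuousAt (x := φ x)).comp hφ.continuousAt).eventually_const_lt hx
  have heq : ((fun v => Real.log (g v)) ∘ ψ) =ᶠ[𝓝 x]
      ((fun v => Real.log (f v)) ∘ φ + fun z => Real.log (ρ z)) := by
    filter_upwards [hev] with z hz
    simp only [Function.comp, Pi.add_apply]
    rw [h, Real.log_mul hz.ne' (hρ0 z).ne']
  have h3 := DFunLike.congr_fun (h1.unique (h2.congr_of_eventuallyEq heq)) w
  simpa [fderiv_log_eq_dotProduct_score] using h3

end Score

/-! ### Factoring one linear map through another. -/

section LinearAlgebra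

variable {E F : Type*} [AddCommGroup E] [Module ℝ E] [FiniteDimensional ℝ E]
  [AddCommGroup F] [Module ℝ F] [FiniteDimensional ℝ F]

/-- Rank-nullity: a smaller kernel forces rank `S` to be at least rank `R`, which is already full.
Then `B` is `R` composed with a right inverse of `S`. -/
lemma surjective_and_exists_factor_of_ker_le (R S : E →ₗ[ℝ] F) (hR : Function.Surjective R)
    (h : LinearMap.ker S ≤ LinearMap.ker R) :
    Function.Surjective S ∧ ∃ B : F →ₗ[ℝ] F, R = B ∘ₗ S := by
  have hS : LinearMap.range S = ⊤ := by
    apply Submodule.eq_top_of_finrank_eq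
    have h1 := S.finrank_range_add_finrank_ker
    have h2 := R.finrank_range_add_finrank_ker
    have h3 := Submodule.finrank_mono h
    have h4 := Submodule.finrank_le (LinearMap.range S)
    rw [LinearMap.range_eq_top.2 hR, finrank_top] at h2
    omega
  refine ⟨LinearMap.range_eq_top.1 hS, ?_⟩
  obtain ⟨T, hT⟩ := S.exists_rightInverse_of_surjective hS
  refine ⟨R ∘ₗ T, LinearMap.ext fun z => ?_⟩
  have hz : z - T (S z) ∈ LinearMap.ker S := by
    have := LinearMap.congr_fun hT (S z)
    simp only [LinearMap.comp_apply, LinearMap.id_apply] at this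
    simp [this]
  have := h hz
  rw [LinearMap.mem_ker, map_sub, sub_eq_zero] at this
  simpa using this

end LinearAlgebra

/-! ### Moments of densities under affine maps. -/

section Moments

variable {n : ℕ}

lemma integrable_and_integral_comp_affine {M : Matrix (Fin n) (Fin n) ℝ} (hM : M.det ≠ 0)
    (c : Fin n → ℝ) (h : (Fin n → ℝ) → ℝ) :
    (Integrable h ↔ Integrable fun v => |M.det| * h (M *ᵥ v + c)) ∧
      ∫ u, h u = ∫ v, |M.det| * h (M *ᵥ v + c) := by
  set L : (Fin n → ℝ) →L[ℝ] (Fin n → ℝ) := (Matrix.toLin' M).toContinuousLinearMap with hL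
  have hdet : L.det = M.det := by
    rw [ContinuousLinearMap.det, hL, LinearMap.coe_toContinuousLinearMap, LinearMap.det_toLin']
  have hunit : IsUnit M.det := isUnit_iff_ne_zero.2 hM
  have hder : ∀ x ∈ (Set.univ : Set (Fin n → ℝ)),
      HasFDerivWithinAt (fun v => M *ᵥ v + c) L Set.univ x := fun x _ =>
    (L.hasFDerivAt.add_const c).hasFDerivWithinAt
  have hinj : Set.InjOn (fun v => M *ᵥ v + c) Set.univ := by
    intro a _ b _ hab
    exact Matrix.mulVec_injective_iff_isUnit.2 ((Matrix.isUnit_iff_isUnit_det M).2 hunit)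
      (add_right_cancel hab)
  have himg : (fun v => M *ᵥ v + c) '' Set.univ = Set.univ := by
    rw [Set.image_univ, Set.range_eq_univ]
    intro u
    refine ⟨M⁻¹ *ᵥ (u - c), ?_⟩
    simp [Matrix.mulVec_mulVec, Matrix.mul_nonsing_inv _ hunit]
  constructor
  · have := integrableOn_image_iff_integrableOn_abs_det_fderiv_smul volume MeasurableSet.univ
      hder hinj h
    simpa only [himg, integrableOn_univ, hdet, smul_eq_mul] using this
  · have := integral_image_eq_integral_abs_det_fderiv_smul volume MeasurableSet.univ
      hder hinj h
    simpa only [himg, setIntegral_univ, hdet, smul_eq_mul] using this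

variable {f : (Fin n → ℝ) → ℝ}

lemma IsAdmissibleDensity.mean_mulVec (hf : IsAdmissibleDensity f)
    (M : Matrix (Fin n) (Fin n) ℝ) (i : Fin n) :
    Integrable (fun u => (M *ᵥ u) i * f u) ∧ ∫ u, (M *ᵥ u) i * f u = 0 := by
  have h : (fun u : Fin n → ℝ => (M *ᵥ u) i * f u) = fun u => ∑ a, M i a * (u a * f u) := by
    ext u
    simp only [Matrix.mulVec, dotProduct, Finset.sum_mul, mul_assoc]
  have hi : ∀ a ∈ Finset.univ, Integrable fun u : Fin n → ℝ => M i a * (u a * f u) :=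
    fun a _ => (hf.integrable_mean a).const_mul _
  rw [h]
  refine ⟨integrable_finsetSum _ hi, ?_⟩
  rw [integral_finsetSum _ hi]
  simp [integral_const_mul, hf.mean]

lemma IsAdmissibleDensity.cov_mulVec (hf : IsAdmissibleDensity f)
    (M : Matrix (Fin n) (Fin n) ℝ) (i j : Fin n) :
    Integrable (fun u => (M *ᵥ u) i * (M *ᵥ u) j * f u) ∧
      ∫ u, (M *ᵥ u) i * (M *ᵥ u) j * f u = (M * Mᵀ) i j := by
  have h : (fun u : Fin n → ℝ => (M *ᵥ u) i * (M *ᵥ u) j * f u) =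
      fun u => ∑ a, ∑ b, M i a * M j b * (u a * u b * f u) := by
    ext u
    simp only [Matrix.mulVec, dotProduct]
    rw [Finset.sum_mul_sum, Finset.sum_mul]
    refine Finset.sum_congr rfl fun a _ => ?_
    rw [Finset.sum_mul]
    exact Finset.sum_congr rfl fun b _ => by ring
  have hi : ∀ a b, Integrable fun u : Fin n → ℝ => M i a * M j b * (u a * u b * f u) :=
    fun a b => (hf.integrable_cov a b).const_mul _
  have hi' : ∀ a ∈ Finset.univ,
      Integrable fun u : Fin n → ℝ => ∑ b, M i a * M j b * (u a * u b * f u) :=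
    fun a _ => integrable_finsetSum _ fun b _ => hi a b
  rw [h]
  refine ⟨integrable_finsetSum _ hi', ?_⟩
  rw [integral_finsetSum _ hi', Matrix.mul_apply]
  refine Finset.sum_congr rfl fun a _ => ?_
  rw [integral_finsetSum _ fun b _ => hi a b]
  simp [integral_const_mul, hf.cov, Matrix.one_apply]

lemma abs_det_of_mem_orthogonalGroup {Q : Matrix (Fin n) (Fin n) ℝ}
    (hQ : Q ∈ Matrix.orthogonalGroup (Fin n) ℝ) : |Q.det| = 1 := by
  have := congrArg Matrix.det ((Matrix.mem_orthogonalGroup_iff (Fin n) ℝ).1 hQ)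
  rw [Matrix.det_mul, Matrix.det_transpose, Matrix.det_one] at this
  rcases mul_self_eq_one_iff.1 this with h | h <;> simp [h]

/-- An orthogonal transform of an admissible density is admissible. -/
lemma IsAdmissibleDensity.comp_orthogonal (hf : IsAdmissibleDensity f)
    {Q : Matrix (Fin n) (Fin n) ℝ} (hQ : Q ∈ Matrix.orthogonalGroup (Fin n) ℝ) :
    IsAdmissibleDensity fun u => f (Qᵀ *ᵥ u) := by
  have hQQ : Q * Qᵀ = 1 := (Matrix.mem_orthogonalGroup_iff (Fin n) ℝ).1 hQ
  have hQQ' : Qᵀ * Q = 1 := (Matrix.mem_orthogonalGroup_iff' (Fin n) ℝ).1 hQ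
  have hdet : |Q.det| = 1 := abs_det_of_mem_orthogonalGroup hQ
  have hdet0 : Qᵀ.det ≠ 0 := by
    intro h
    rw [← Matrix.det_transpose, h] at hdet
    simp at hdet
  have hinv : ∀ u, Q *ᵥ (Qᵀ *ᵥ u) = u := fun u => by
    rw [Matrix.mulVec_mulVec, hQQ, Matrix.one_mulVec]
  have hinv' : ∀ u, Qᵀ *ᵥ (Q *ᵥ u) = u := fun u => by
    rw [Matrix.mulVec_mulVec, hQQ', Matrix.one_mulVec]
  have key : ∀ h : (Fin n → ℝ) → ℝ, (Integrable h ↔ Integrable fun v => h (Qᵀ *ᵥ v)) ∧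
      ∫ u, h u = ∫ v, h (Qᵀ *ᵥ v) := fun h => by
    simpa [hdet] using integrable_and_integral_comp_affine hdet0 0 h
  -- The test functions contain `Q *ᵥ u` so that substituting `Qᵀ *ᵥ v` leaves plain coordinates of
  -- `v`: moments of the new density are moments of `Q u` under `f`.
  have kmean := fun i => key fun u => (Q *ᵥ u) i * f u
  have kcov := fun i j => key fun u => (Q *ᵥ u) i * (Q *ᵥ u) j * f u
  simp only [hinv] at kmean kcov
  have hcont : ∀ M : Matrix (Fin n) (Fin n) ℝ, Continuous fun u => M *ᵥ u := fun M =>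
    (Matrix.toLin' M).continuous_of_finiteDimensional
  refine ⟨⟨fun u => hf.isDensity.nonneg _, (key f).1.1 hf.isDensity.integrable,
    (key f).2.symm.trans hf.isDensity.integral_eq_one⟩, ?_, ?_,
    fun i => (kmean i).1.1 (hf.mean_mulVec Q i).1,
    fun i => (kmean i).2.symm.trans (hf.mean_mulVec Q i).2,
    fun i j => (kcov i j).1.1 (hf.cov_mulVec Q i j).1,
    fun i j => (kcov i j).2.symm.trans ?_⟩
  · exact hf.contDiff.comp (Matrix.toLin' Qᵀ).toContinuousLinearMap.contDiff
  · let e : (Fin n → ℝ) ≃ₜ (Fin n → ℝ) :=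
      { toFun := fun u => Qᵀ *ᵥ u
        invFun := fun u => Q *ᵥ u
        left_inv := hinv
        right_inv := hinv'
        continuous_toFun := hcont _
        continuous_invFun := hcont _ }
    have := tsupport_comp_eq_preimage f e
    rw [hf.support, Set.preimage_univ] at this
    exact this
  · rw [(hf.cov_mulVec Q i j).2, hQQ]

/-- An affine map carrying one admissible density to another is an orthogonal linear map. -/
lemma IsAdmissibleDensity.orthogonal_of_affine {g : (Fin n → ℝ) → ℝ}
    (hf : IsAdmissibleDensity f) (hg : IsAdmissibleDensity g)
    {M : Matrix (Fin n) (Fin n) ℝ} (hM : M.det ≠ 0) {c : Fin n → ℝ}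
    (h : ∀ v, g v = |M.det| * f (M *ᵥ v + c)) :
    c = 0 ∧ M * Mᵀ = 1 := by
  have hc : c = 0 := by
    ext i
    have h1 := (integrable_and_integral_comp_affine hM c fun u => u i * f u).2
    rw [hf.mean] at h1
    -- Under `g`, the first term has mean zero and the second integrates to `c i`.
    have h2 : (fun v => |M.det| * ((M *ᵥ v + c) i * f (M *ᵥ v + c))) =
        fun v => (M *ᵥ v) i * g v + c i * g v := by
      ext v
      rw [h, Pi.add_apply]
      ring
    rw [h2, integral_add (hg.mean_mulVec M i).1 (hg.isDensity.integrable.const_mul _),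
      (hg.mean_mulVec M i).2, integral_const_mul, hg.isDensity.integral_eq_one] at h1
    simpa using h1.symm
  refine ⟨hc, ?_⟩
  subst hc
  ext i j
  rw [← (hg.cov_mulVec M i j).2, ← hf.cov i j,
    (integrable_and_integral_comp_affine hM 0 fun u => u i * u j * f u).2]
  congr 1
  ext v
  rw [h, add_zero]
  ring

end Moments

/-! ### Integrating a linear relation between derivatives. -/

lemma exists_eq_mulVec_add_of_fderiv {m n : ℕ} {r s : (Fin m → ℝ) → (Fin n → ℝ)}
    (hr : Differentiable ℝ r) (hs : Differentiable ℝ s) {M : Matrix (Fin n) (Fin n) ℝ}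
    (h : ∀ x w, fderiv ℝ r x w = M *ᵥ fderiv ℝ s x w) :
    ∃ c, ∀ x, r x = M *ᵥ s x + c := by
  set L : (Fin n → ℝ) →L[ℝ] (Fin n → ℝ) := (Matrix.toLin' M).toContinuousLinearMap
  have hd : ∀ x, HasFDerivAt (fun x => r x - L (s x)) (0 : (Fin m → ℝ) →L[ℝ] (Fin n → ℝ)) x := by
    intro x
    have h1 := (hr x).hasFDerivAt.sub (L.hasFDerivAt.comp x (hs x).hasFDerivAt)
    refine h1.congr_fderiv ?_
    ext1 w
    exact sub_eq_zero.2 (h x w)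
  refine ⟨r 0 - L (s 0), fun x => ?_⟩
  have := is_const_of_fderiv_eq_zero (fun x => (hd x).differentiableAt)
    (fun x => (hd x).fderiv) x 0
  exact eq_add_of_sub_eq' this

lemma det_jacobian_of_eq_mulVec_add {n : ℕ} {r s : (Fin n → ℝ) → (Fin n → ℝ)}
    (hs : Differentiable ℝ s) {M : Matrix (Fin n) (Fin n) ℝ} {c : Fin n → ℝ}
    (h : ∀ y, r y = M *ᵥ s y + c) (y : Fin n → ℝ) :
    (jacobian r y).det = M.det * (jacobian s y).det := by
  set L : (Fin n → ℝ) →L[ℝ] (Fin n → ℝ) := (Matrix.toLin' M).toContinuousLinearMap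
  have h1 : HasFDerivAt r (L.comp (fderiv ℝ s y)) y := by
    rw [funext h]
    exact (L.hasFDerivAt.comp y (hs y).hasFDerivAt).add_const c
  have h2 : jacobian r y = M * jacobian s y := by
    refine Matrix.toLin'.injective (LinearMap.ext fun w => ?_)
    rw [Matrix.toLin'_apply, Matrix.toLin'_apply, ← Matrix.mulVec_mulVec, jacobian_mulVec,
      jacobian_mulVec, h1.fderiv]
    rfl
  rw [h2, Matrix.det_mul]

/-! ### One matrix relating all derivatives. -/

section Identification

variable {G K₁ K₂ : ℕ} {r₀ s₀ : (Fin G → ℝ) → (Fin G → ℝ)}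
  {r₁ s₁ : (Fin K₁ → ℝ) → (Fin G → ℝ)} {r₂ s₂ : (Fin K₂ → ℝ) → (Fin G → ℝ)}
  {f g : (Fin G → ℝ) → ℝ}

/-- Observational equivalence forces a common linear relation between all derivatives. -/
lemma ObsEquiv.exists_fderiv_eq_mulVec (h : ObsEquiv s₀ s₁ s₂ g r₀ r₁ r₂ f)
    (hDGP : DGP r₁ r₂ f)
    (hr₀ : ContDiff ℝ 2 r₀) (hr₁ : Differentiable ℝ r₁) (hr₂ : Differentiable ℝ r₂)
    (hs₀ : ContDiff ℝ 2 s₀) (hs₁ : Differentiable ℝ s₁) (hs₂ : Differentiable ℝ s₂)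
    (hf : Differentiable ℝ f) (hg : Differentiable ℝ g) (hsurj : Function.Surjective r₀)
    (hrdet : ∀ y, 0 < (jacobian r₀ y).det) (hsdet : ∀ y, 0 < (jacobian s₀ y).det) :
    ∃ M : Matrix (Fin G) (Fin G) ℝ,
      (∀ y w, fderiv ℝ r₀ y w = M *ᵥ fderiv ℝ s₀ y w) ∧
      (∀ x w, fderiv ℝ r₁ x w = M *ᵥ fderiv ℝ s₁ x w) ∧
      (∀ x w, fderiv ℝ r₂ x w = M *ᵥ fderiv ℝ s₂ x w) := by
  have dr₀ : Differentiable ℝ r₀ := hr₀.differentiable (by norm_num)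
  have ds₀ : Differentiable ℝ s₀ := hs₀.differentiable (by norm_num)
  set ρ : (Fin G → ℝ) → ℝ := fun y => (jacobian r₀ y).det * ((jacobian s₀ y).det)⁻¹ with hρ
  have ρpos : ∀ y, 0 < ρ y := fun y => mul_pos (hrdet y) (inv_pos.2 (hsdet y))
  have dρ : Differentiable ℝ ρ :=
    (differentiable_det_jacobian hr₀).mul
      ((differentiable_det_jacobian hs₀).inv fun y => (hsdet y).ne')
  have heq : ∀ y x₁ x₂, g (s₀ y + s₁ x₁ + s₂ x₂) = f (r₀ y + r₁ x₁ + r₂ x₂) * ρ y := by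
    intro y x₁ x₂
    have := h x₁ x₂ y
    simp only [condDensity, abs_of_pos (hrdet y), abs_of_pos (hsdet y)] at this
    rw [hρ, ← mul_assoc, eq_mul_inv_iff_mul_eq₀ (hsdet y).ne', this]
  have e₀ : ∀ y x₁ x₂ w, 0 < f (r₀ y + r₁ x₁ + r₂ x₂) →
      score g (s₀ y + s₁ x₁ + s₂ x₂) ⬝ᵥ fderiv ℝ s₀ y w =
        score f (r₀ y + r₁ x₁ + r₂ x₂) ⬝ᵥ fderiv ℝ r₀ y w +
          fderiv ℝ (fun z => Real.log (ρ z)) y w := by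
    intro y x₁ x₂ w hpos
    have := score_dotProduct_fderiv (φ := fun z => r₀ z + r₁ x₁ + r₂ x₂)
      (ψ := fun z => s₀ z + s₁ x₁ + s₂ x₂) (x := y) hf hg
      (((dr₀ y).add_const _).add_const _) (((ds₀ y).add_const _).add_const _) (dρ y) ρpos
      hpos (fun z => heq z x₁ x₂) w
    simpa only [fderiv_add_const] using this
  have e₁ : ∀ y x₁ x₂ w, 0 < f (r₀ y + r₁ x₁ + r₂ x₂) →
      score g (s₀ y + s₁ x₁ + s₂ x₂) ⬝ᵥ fderiv ℝ s₁ x₁ w =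
        score f (r₀ y + r₁ x₁ + r₂ x₂) ⬝ᵥ fderiv ℝ r₁ x₁ w := by
    intro y x₁ x₂ w hpos
    -- With `y` fixed the Jacobian factor is constant, so its logarithmic derivative drops out.
    have := score_dotProduct_fderiv (φ := fun z => r₀ y + r₁ z + r₂ x₂)
      (ψ := fun z => s₀ y + s₁ z + s₂ x₂) (ρ := fun _ => ρ y) (x := x₁) hf hg
      (((hr₁ x₁).const_add _).add_const _) (((hs₁ x₁).const_add _).add_const _)
      (differentiableAt_const _) (fun _ => ρpos y) hpos (fun z => heq y z x₂) w
    simpa [fderiv_add_const, fderiv_const_add] using this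
  have e₂ : ∀ y x₁ x₂ w, 0 < f (r₀ y + r₁ x₁ + r₂ x₂) →
      score g (s₀ y + s₁ x₁ + s₂ x₂) ⬝ᵥ fderiv ℝ s₂ x₂ w =
        score f (r₀ y + r₁ x₁ + r₂ x₂) ⬝ᵥ fderiv ℝ r₂ x₂ w := by
    intro y x₁ x₂ w hpos
    have := score_dotProduct_fderiv (φ := fun z => r₀ y + r₁ x₁ + r₂ z)
      (ψ := fun z => s₀ y + s₁ x₁ + s₂ z) (ρ := fun _ => ρ y) (x := x₂) hf hg
      ((hr₂ x₂).const_add _) ((hs₂ x₂).const_add _)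
      (differentiableAt_const _) (fun _ => ρpos y) hpos (fun z => heq y x₁ z) w
    simpa [fderiv_const_add] using this
  obtain ⟨u, hu, hspan⟩ := hDGP.span
  have solve_y : ∀ x₁ x₂ v, ∃ y, r₀ y + r₁ x₁ + r₂ x₂ = v := fun x₁ x₂ v => by
    obtain ⟨y, hy⟩ := hsurj (v - r₁ x₁ - r₂ x₂)
    exact ⟨y, by rw [hy]; abel⟩
  have solve_x : ∀ y v, ∃ x₁ x₂, r₀ y + r₁ x₁ + r₂ x₂ = v := fun y v => by
    obtain ⟨x, hx⟩ : v - r₀ y ∈ Set.range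
      (fun x : (Fin K₁ → ℝ) × (Fin K₂ → ℝ) => r₁ x.1 + r₂ x.2) := hDGP.image ▸ Set.mem_univ _
    exact ⟨x.1, x.2, by rw [add_assoc, show r₁ x.1 + r₂ x.2 = v - r₀ y from hx]; abel⟩
  have sep : ∀ a b : Fin G → ℝ, (∀ i, score f (u i) ⬝ᵥ a = score f (u i) ⬝ᵥ b) → a = b :=
    fun a b hab => sub_eq_zero.1 <| eq_zero_of_score_dotProduct_eq_zero hspan fun i => by
      rw [dotProduct_sub, hab, sub_self]
  have fac₁ : ∀ x₁, Function.Surjective (fderiv ℝ s₁ x₁) ∧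
      ∃ B : (Fin G → ℝ) →ₗ[ℝ] (Fin G → ℝ), ∀ w, fderiv ℝ r₁ x₁ w = B (fderiv ℝ s₁ x₁ w) := by
    intro x₁
    obtain ⟨hS, B, hB⟩ := surjective_and_exists_factor_of_ker_le
      (fderiv ℝ r₁ x₁ : (Fin K₁ → ℝ) →ₗ[ℝ] (Fin G → ℝ)) (fderiv ℝ s₁ x₁)
      (surjective_fderiv_of_rank_jacobian (hDGP.rank₁ x₁)) fun w hw => by
        refine sep _ _ fun i => ?_
        -- Only `x₁` is prescribed; `x₂ = 0` is arbitrary, since `y` alone moves the index to `u i`.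
        obtain ⟨y, hy⟩ := solve_y x₁ 0 (u i)
        have := e₁ y x₁ 0 w (hy ▸ hu i)
        rw [hy, show fderiv ℝ s₁ x₁ w = 0 from hw, dotProduct_zero] at this
        rw [dotProduct_zero]
        exact this.symm
    exact ⟨hS, B, fun w => LinearMap.congr_fun hB w⟩
  have fac₂ : ∀ x₂, Function.Surjective (fderiv ℝ s₂ x₂) ∧
      ∃ B : (Fin G → ℝ) →ₗ[ℝ] (Fin G → ℝ), ∀ w, fderiv ℝ r₂ x₂ w = B (fderiv ℝ s₂ x₂ w) := by
    intro x₂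
    obtain ⟨hS, B, hB⟩ := surjective_and_exists_factor_of_ker_le
      (fderiv ℝ r₂ x₂ : (Fin K₂ → ℝ) →ₗ[ℝ] (Fin G → ℝ)) (fderiv ℝ s₂ x₂)
      (surjective_fderiv_of_rank_jacobian (hDGP.rank₂ x₂)) fun w hw => by
        refine sep _ _ fun i => ?_
        obtain ⟨y, hy⟩ := solve_y 0 x₂ (u i)
        have := e₂ y 0 x₂ w (hy ▸ hu i)
        rw [hy, show fderiv ℝ s₂ x₂ w = 0 from hw, dotProduct_zero] at this
        rw [dotProduct_zero]
        exact this.symm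
    exact ⟨hS, B, fun w => LinearMap.congr_fun hB w⟩
  choose hS₁ B₁ hB₁ using fac₁
  choose hS₂ B₂ hB₂ using fac₂
  have q₁ : ∀ y x₁ x₂ v, 0 < f (r₀ y + r₁ x₁ + r₂ x₂) →
      score g (s₀ y + s₁ x₁ + s₂ x₂) ⬝ᵥ v = score f (r₀ y + r₁ x₁ + r₂ x₂) ⬝ᵥ B₁ x₁ v := by
    intro y x₁ x₂ v hpos
    obtain ⟨w, rfl⟩ := hS₁ x₁ v
    rw [← hB₁, e₁ _ _ _ _ hpos]
  have q₂ : ∀ y x₁ x₂ v, 0 < f (r₀ y + r₁ x₁ + r₂ x₂) →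
      score g (s₀ y + s₁ x₁ + s₂ x₂) ⬝ᵥ v = score f (r₀ y + r₁ x₁ + r₂ x₂) ⬝ᵥ B₂ x₂ v := by
    intro y x₁ x₂ v hpos
    obtain ⟨w, rfl⟩ := hS₂ x₂ v
    rw [← hB₂, e₂ _ _ _ _ hpos]
  -- Two separate regressors are what make `B` constant: one side depends only on `x₁`, the other
  -- only on `x₂`.
  have hBB : ∀ x₁ x₂ v, B₁ x₁ v = B₂ x₂ v := by
    intro x₁ x₂ v
    refine sep _ _ fun i => ?_
    obtain ⟨y, hy⟩ := solve_y x₁ x₂ (u i)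
    have hpos : 0 < f (r₀ y + r₁ x₁ + r₂ x₂) := hy ▸ hu i
    rw [← hy, ← q₁ _ _ _ _ hpos, q₂ _ _ _ _ hpos]
  have hB₁c : ∀ x₁ v, B₁ x₁ v = B₁ 0 v := fun x₁ v => (hBB x₁ 0 v).trans (hBB 0 0 v).symm
  have hρ' : ∀ y w, fderiv ℝ (fun z => Real.log (ρ z)) y w = 0 := by
    intro y w
    obtain ⟨v, hv, hv0⟩ := hDGP.mode
    obtain ⟨x₁, x₂, hx⟩ := solve_x y v
    have hpos : 0 < f (r₀ y + r₁ x₁ + r₂ x₂) := hx ▸ hv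
    have := e₀ y x₁ x₂ w hpos
    -- By `q₁`, the score of `g` vanishes wherever that of `f` does, leaving only the `log ρ` term.
    rw [q₁ _ _ _ _ hpos, hx, hv0] at this
    simpa using this.symm
  have hM : ∀ v, LinearMap.toMatrix' (B₁ 0) *ᵥ v = B₁ 0 v := fun v =>
    LinearMap.toMatrix'_mulVec _ _
  refine ⟨LinearMap.toMatrix' (B₁ 0), fun y w => ?_, fun x w => ?_, fun x w => ?_⟩
  · rw [hM]
    refine sep _ _ fun i => ?_
    obtain ⟨x₁, x₂, hx⟩ := solve_x y (u i)
    have hpos : 0 < f (r₀ y + r₁ x₁ + r₂ x₂) := hx ▸ hu i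
    have := e₀ y x₁ x₂ w hpos
    rw [q₁ _ _ _ _ hpos, hx, hρ', add_zero, hB₁c] at this
    exact this.symm
  · rw [hM, hB₁, hB₁c]
  · rw [hM, hB₂, hBB 0 x]

end Identification

end SimEq

theorem mainTheorem10 {G K₁ K₂ : ℕ}
    (Γ₀ : Set ((Fin G → ℝ) → (Fin G → ℝ)))
    (Γ₁ : Set ((Fin K₁ → ℝ) → (Fin G → ℝ)))
    (Γ₂ : Set ((Fin K₂ → ℝ) → (Fin G → ℝ)))
    (Φ : Set ((Fin G → ℝ) → ℝ))
    (hPAR : SimEq.PAR Γ₀ Γ₁ Γ₂ Φ)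
    (r₀ : (Fin G → ℝ) → (Fin G → ℝ)) (hr₀ : r₀ ∈ Γ₀)
    (r₁ : (Fin K₁ → ℝ) → (Fin G → ℝ)) (hr₁ : r₁ ∈ Γ₁)
    (r₂ : (Fin K₂ → ℝ) → (Fin G → ℝ)) (hr₂ : r₂ ∈ Γ₂)
    (f : (Fin G → ℝ) → ℝ) (hf : f ∈ Φ)
    (hDGP : SimEq.DGP r₁ r₂ f)
    -- `Φ` omits no admissible density that is an orthogonal transform of `f`
    -- (automatic when `Φ` is the set of all admissible densities)
    (hΦ : ∀ Q ∈ Matrix.orthogonalGroup (Fin G) ℝ,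
      SimEq.IsAdmissibleDensity (fun u => f (Qᵀ *ᵥ u)) → (fun u => f (Qᵀ *ᵥ u)) ∈ Φ)
    (s₀ : (Fin G → ℝ) → (Fin G → ℝ)) (hs₀ : s₀ ∈ Γ₀)
    (s₁ : (Fin K₁ → ℝ) → (Fin G → ℝ)) (hs₁ : s₁ ∈ Γ₁)
    (s₂ : (Fin K₂ → ℝ) → (Fin G → ℝ)) (hs₂ : s₂ ∈ Γ₂) :
    (∃ g ∈ Φ, SimEq.ObsEquiv s₀ s₁ s₂ g r₀ r₁ r₂ f) ↔
      ∃ Q ∈ Matrix.orthogonalGroup (Fin G) ℝ, ∀ y x₁ x₂,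
        s₀ y + s₁ x₁ + s₂ x₂ = Q *ᵥ (r₀ y + r₁ x₁ + r₂ x₂) := by
  have dr₀ : Differentiable ℝ r₀ := (hPAR.contDiff₀ r₀ hr₀).differentiable (by norm_num)
  have ds₀ : Differentiable ℝ s₀ := (hPAR.contDiff₀ s₀ hs₀).differentiable (by norm_num)
  have hfa := hPAR.density f hf
  constructor
  · rintro ⟨g, hg, h⟩
    have hga := hPAR.density g hg
    have dr₁ : Differentiable ℝ r₁ := (hPAR.contDiff₁ r₁ hr₁).differentiable (by norm_num)
    have ds₁ : Differentiable ℝ s₁ := (hPAR.contDiff₁ s₁ hs₁).differentiable (by norm_num)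
    have dr₂ : Differentiable ℝ r₂ := (hPAR.contDiff₂ r₂ hr₂).differentiable (by norm_num)
    have ds₂ : Differentiable ℝ s₂ := (hPAR.contDiff₂ s₂ hs₂).differentiable (by norm_num)
    obtain ⟨M, h₀, h₁, h₂⟩ := h.exists_fderiv_eq_mulVec hDGP
      (hPAR.contDiff₀ r₀ hr₀) dr₁ dr₂ (hPAR.contDiff₀ s₀ hs₀) ds₁ ds₂
      (hfa.contDiff.differentiable (by norm_num)) (hga.contDiff.differentiable (by norm_num))
      (hPAR.bijective r₀ hr₀).2 (hPAR.det_pos r₀ hr₀) (hPAR.det_pos s₀ hs₀)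
    obtain ⟨c₀, hc₀⟩ := SimEq.exists_eq_mulVec_add_of_fderiv dr₀ ds₀ h₀
    obtain ⟨c₁, hc₁⟩ := SimEq.exists_eq_mulVec_add_of_fderiv dr₁ ds₁ h₁
    obtain ⟨c₂, hc₂⟩ := SimEq.exists_eq_mulVec_add_of_fderiv dr₂ ds₂ h₂
    have hsum : ∀ y x₁ x₂, r₀ y + r₁ x₁ + r₂ x₂ =
        M *ᵥ (s₀ y + s₁ x₁ + s₂ x₂) + (c₀ + c₁ + c₂) := by
      intro y x₁ x₂
      rw [hc₀, hc₁, hc₂, Matrix.mulVec_add, Matrix.mulVec_add]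
      abel
    have hdet := SimEq.det_jacobian_of_eq_mulVec_add ds₀ hc₀
    have hM : M.det ≠ 0 := by
      intro h0
      have := hPAR.det_pos r₀ hr₀ 0
      rw [hdet, h0, zero_mul] at this
      exact this.false
    obtain ⟨hc, hMM⟩ := hfa.orthogonal_of_affine hga hM (c := c₀ + c₁ + c₂) fun v => by
      -- Since `s₀` is onto, the slice `x₁ = x₂ = 0` already reaches every `v`.
      obtain ⟨y, hy⟩ := (hPAR.bijective s₀ hs₀).2 (v - s₁ 0 - s₂ 0)
      have hv : s₀ y + s₁ 0 + s₂ 0 = v := by rw [hy]; abel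
      have := h 0 0 y
      simp only [SimEq.condDensity] at this
      rw [hsum, hv, hdet, abs_mul, ← mul_assoc] at this
      rw [mul_right_cancel₀ (abs_pos.2 (hPAR.det_pos s₀ hs₀ y).ne').ne' this, mul_comm]
    have hMM' : Mᵀ * M = 1 := mul_eq_one_comm.1 hMM
    -- `M` carries `s` to `r`, so `Q` is its inverse.
    refine ⟨Mᵀ, (Matrix.mem_orthogonalGroup_iff (Fin G) ℝ).2 ?_, fun y x₁ x₂ => ?_⟩
    · exact hMM'
    · rw [hsum, hc, add_zero, Matrix.mulVec_mulVec, hMM', Matrix.one_mulVec]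
  · rintro ⟨Q, hQ, h⟩
    have hQQ : Qᵀ * Q = 1 := (Matrix.mem_orthogonalGroup_iff' (Fin G) ℝ).1 hQ
    refine ⟨_, hΦ Q hQ (hfa.comp_orthogonal hQ), fun x₁ x₂ y => ?_⟩
    -- At fixed `x₁, x₂`, solving the hypothesis for `s₀` gives `Q r₀` plus this constant.
    have hdet := SimEq.det_jacobian_of_eq_mulVec_add (r := s₀) (M := Q)
      (c := Q *ᵥ (r₁ x₁ + r₂ x₂) - (s₁ x₁ + s₂ x₂)) dr₀ (fun z => by
        have := h z x₁ x₂
        rw [add_assoc, add_assoc, Matrix.mulVec_add] at this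
        rw [← add_sub_assoc, ← this, add_sub_cancel_right]) y
    simp only [SimEq.condDensity]
    rw [hdet, abs_mul, SimEq.abs_det_of_mem_orthogonalGroup hQ, one_mul, h,
      Matrix.mulVec_mulVec, hQQ, Matrix.one_mulVec]
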